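/- Let $\mathcal G=(\mathcal V,\mathcal E,\mathcal W)$ be a finite simple undirected graph with a weight function $\mathcal W:\mathcal E\to\mathbb R\setminus\{0\}$. Let $E$ be its incidence matrix (for any orientation of the edges), $W$ the diagonal matrix of the edge weights, and $L(\mathcal G)=EWE^T$ its weighted Laplacian. Let $\mathcal E_+$ and $\mathcal E_-$ be the sets of edges with positive and negative weight, and let $\mathcal G_+=(\mathcal V,\mathcal E_+,\mathcal W|_{\mathcal E_+})$. For nodes $u,v\in\mathcal V$ let $$\mathcal R_{uv}(\mathcal G_+)=(\mathbf e_u-\mathbf e_v)^T L(\mathcal G_+)^\dagger(\mathbf e_u-\mathbf e_v)$$ be the effective resistance between $u$ and $v$ in $\mathcal G_+$, where $\dagger$ denotes the Moore–Penrose pseudo-inverse and $\mathbf e_u$ the indicator vector of $u$. For $k=\{u,v\}\in\mathcal E_-$ write $\mathcal R_k(\mathcal G_+)=\mathcal R_{uv}(\mathcal G_+)$, and let $P_k\subseteq\mathcal E_+$ be the set of all edges that lie on some simple path in $\mathcal G_+$ from $u$ to $v$. Let $\mathbf R=\mathrm{diag}(\mathcal R_k(\mathcal G_+))_{k\in\mathcal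 E_-}$ and $|W_-|=\mathrm{diag}(|\mathcal W(k)|)_{k\in\mathcal E_-}$. Theorem. Assume that $\mathcal G_+$ is connected, that $|\mathcal E_-|>1$, and that $P_i\cap P_j=\emptyset$ for all distinct $i,j\in\mathcal E_-$. Then $\mathbf R$ is invertible, and $L(\mathcal G)$ is positive semidefinite if and only if $|W_-|\le\mathbf R^{-1}$, that is, if and only if the diagonal matrix $\mathbf R^{-1}-|W_-|$ is positive semidefinite (equivalently, $|\mathcal W(k)|\le\mathcal R_k(\mathcal G_+)^{-1}$ for every $k\in\mathcal E_-$). -/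

import Mathlib

/-- An undirected weighted graph `(V, E, w)` with nonzero real edge weights of either sign. -/
structure WeightedGraph (V : Type*) where
  graph : SimpleGraph V
  weight : graph.edgeSet → ℝ
  weight_ne_zero : ∀ e, weight e ≠ 0

/-- `X` satisfies the four Penrose equations for the real matrix `A`. -/
structure IsMoorePenroseInverse {m n : Type*} [Fintype m] [Fintype n]
    (A : Matrix m n ℝ) (X : Matrix n m ℝ) : Prop where
  mul_mul_self : A * X * A = A
  mul_self_mul : X * A * X = X
  left_symm : (A * X).transpose = A * X
  right_symm : (X * A).transpose = X * A

theorem IsMoorePenroseInverse.unique {m n : Type*} [Fintype m] [Fintype n]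
    {A : Matrix m n ℝ} {X Y : Matrix n m ℝ}
    (hX : IsMoorePenroseInverse A X) (hY : IsMoorePenroseInverse A Y) : X = Y := by
  have h1 : A * X = A * Y := by
    calc A * X = (A * X).transpose := hX.left_symm.symm
      _ = ((A * Y) * (A * X)).transpose := by
          rw [← Matrix.mul_assoc, hY.mul_mul_self]
      _ = (A * X) * (A * Y) := by
          rw [Matrix.transpose_mul, hX.left_symm, hY.left_symm]
      _ = A * Y := by rw [← Matrix.mul_assoc, hX.mul_mul_self]
  have h2 : X * A = Y * A := by
    calc X * A = (X * A).transpose := hX.right_symm.symm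
      _ = ((X * A) * (Y * A)).transpose := by
          rw [Matrix.mul_assoc X A, ← Matrix.mul_assoc A Y A, hY.mul_mul_self]
      _ = (Y * A) * (X * A) := by
          rw [Matrix.transpose_mul, hX.right_symm, hY.right_symm]
      _ = Y * A := by
          rw [Matrix.mul_assoc Y A, ← Matrix.mul_assoc A X A, hX.mul_mul_self]
  calc X = X * A * X := hX.mul_self_mul.symm
    _ = Y * A * Y := by rw [h2, Matrix.mul_assoc, h1, ← Matrix.mul_assoc]
    _ = Y := hY.mul_self_mul

open Classical in
theorem exists_isMoorePenroseInverse {n : Type*} [Fintype n]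
    (A : Matrix n n ℝ) (hA : A.IsSymm) : ∃ X, IsMoorePenroseInverse A X := by
  have hH : A.IsHermitian := by
    rw [Matrix.IsHermitian, Matrix.conjTranspose_eq_transpose_of_trivial]; exact hA
  obtain ⟨U, hU, D, hD⟩ : ∃ U : Matrix n n ℝ, U.transpose * U = 1 ∧
      ∃ D : n → ℝ, A = U * Matrix.diagonal D * U.transpose := by
    refine ⟨hH.eigenvectorUnitary, ?_, hH.eigenvalues, ?_⟩
    · have := Unitary.coe_star_mul_self hH.eigenvectorUnitary
      simpa [Matrix.star_eq_conjTranspose] using this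
    · have := hH.spectral_theorem
      simpa [Unitary.conjStarAlgAut_apply, Matrix.star_eq_conjTranspose, Function.comp_def]
        using this
  have key : ∀ M N : Matrix n n ℝ,
      (U * M * U.transpose) * (U * N * U.transpose) = U * (M * N) * U.transpose := by
    intro M N
    calc (U * M * U.transpose) * (U * N * U.transpose)
        = U * M * (U.transpose * U) * N * U.transpose := by simp only [Matrix.mul_assoc]
      _ = _ := by rw [hU]; simp only [Matrix.mul_assoc, Matrix.one_mul]
  refine ⟨U * Matrix.diagonal (fun i => (D i)⁻¹) * U.transpose, ?_, ?_, ?_, ?_⟩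
  · rw [hD, key, key]; simp
  · rw [hD, key, key]
    simp only [Matrix.diagonal_mul_diagonal]
    congr 3
    funext i
    by_cases h : D i = 0 <;> simp [h]
  · rw [hD, key]; simp [Matrix.mul_assoc]
  · rw [hD, key]; simp [Matrix.mul_assoc]

/-- The Moore-Penrose pseudo-inverse of a real symmetric matrix. -/
noncomputable def symmPseudoInverse {n : Type*} [Fintype n]
    (A : Matrix n n ℝ) (hA : A.IsSymm) : Matrix n n ℝ :=
  (exists_isMoorePenroseInverse A hA).choose

namespace WeightedGraph

variable {V : Type*}

/-- The edges of `G`. -/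
abbrev Edge (G : WeightedGraph V) : Type _ := G.graph.edgeSet

/-- The edges of `G` with negative weight. -/
abbrev NegEdge (G : WeightedGraph V) : Type _ := {e : G.Edge // G.weight e < 0}

noncomputable instance instFintypeEdge [Fintype V] (G : WeightedGraph V) : Fintype G.Edge :=
  Fintype.ofFinite _

noncomputable instance instFintypeNegEdge [Fintype V] (G : WeightedGraph V) :
    Fintype G.NegEdge :=
  Fintype.ofFinite _

noncomputable instance instDecidableEqEdge (G : WeightedGraph V) : DecidableEq G.Edge :=
  Classical.decEq _

/-- The subgraph of `G` on the same node set whose edges are those of positive weight. -/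
def posPart (G : WeightedGraph V) : WeightedGraph V where
  graph :=
    { Adj := fun u v => ∃ h : s(u, v) ∈ G.graph.edgeSet, 0 < G.weight ⟨s(u, v), h⟩
      symm := by
        constructor
        rintro u v h
        rw [Sym2.eq_swap]
        exact h
      loopless := by
        constructor
        rintro u ⟨h, -⟩
        exact G.graph.loopless.irrefl u h }
  weight := fun e => G.weight ⟨e.1, by
    obtain ⟨e, he⟩ := e
    induction e with
    | _ u v => exact he.1⟩
  weight_ne_zero := fun _ => G.weight_ne_zero _

open Classical in
/-- The incidence matrix, each edge being given the (arbitrary but fixed) orientation from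
`e.1.out.1` to `e.1.out.2`. -/
noncomputable def incidenceMatrix (G : WeightedGraph V) : Matrix V G.Edge ℝ :=
  fun v e => (if v = (Quot.out e.1).1 then 1 else 0) - (if v = (Quot.out e.1).2 then 1 else 0)

/-- The weighted Laplacian `E W Eᵀ`. -/
noncomputable def laplacian [Fintype V] (G : WeightedGraph V) : Matrix V V ℝ :=
  G.incidenceMatrix * Matrix.diagonal G.weight * G.incidenceMatrix.transpose

theorem laplacian_isSymm [Fintype V] (G : WeightedGraph V) : G.laplacian.IsSymm := by
  simp [Matrix.IsSymm, laplacian, Matrix.mul_assoc]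

open Classical in
/-- The effective resistance `(e_u - e_v)ᵀ L† (e_u - e_v)`. -/
noncomputable def effectiveResistance [Fintype V] (G : WeightedGraph V) (u v : V) : ℝ :=
  (Pi.single u 1 - Pi.single v 1 : V → ℝ) ⬝ᵥ
    (symmPseudoInverse G.laplacian G.laplacian_isSymm).mulVec (Pi.single u 1 - Pi.single v 1)

open Classical in
theorem effectiveResistance_comm [Fintype V] (G : WeightedGraph V) (u v : V) :
    G.effectiveResistance u v = G.effectiveResistance v u := by
  unfold effectiveResistance
  rw [← neg_sub (Pi.single v 1 : V → ℝ) (Pi.single u 1), Matrix.mulVec_neg, neg_dotProduct_neg]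

/-- The effective resistance between the endpoints of an (unordered) pair of nodes. -/
noncomputable def pairResistance [Fintype V] (G : WeightedGraph V) (k : Sym2 V) : ℝ :=
  Sym2.lift ⟨G.effectiveResistance, G.effectiveResistance_comm⟩ k

/-- The diagonal matrix of the effective resistances over the positive part of `G` between the
endpoints of the negative edges of `G`. -/
noncomputable def resistanceMatrix [Fintype V] (G : WeightedGraph V) :
    Matrix G.NegEdge G.NegEdge ℝ :=
  Matrix.diagonal fun k => G.posPart.pairResistance k.1.1

/-- The diagonal matrix of the absolute values of the negative weights. -/
noncomputable def absNegWeightMatrix (G : WeightedGraph V) : Matrix G.NegEdge G.NegEdge ℝ :=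
  Matrix.diagonal fun k => |G.weight k.1|

/-- The edges of the positive part of `G` that lie on some (simple) path in the positive part
joining the endpoints of the negative edge `k`. -/
def pathEdges (G : WeightedGraph V) (k : G.NegEdge) : Set (Sym2 V) :=
  {e | ∃ u v : V, k.1.1 = s(u, v) ∧ ∃ p : G.posPart.graph.Walk u v, p.IsPath ∧ e ∈ p.edges}

end WeightedGraph

open Matrix

/-! With `L₊` the Laplacian of `G.posPart` and `b_k` the signed indicator of the endpoints of a
negative edge `k`, the form of `G` is `xᵀ L₊ x - ∑ |w_k| (b_kᵀ x)²`. Let `z_k = L₊† b_k` be the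
potential of a unit current across `k`. Connectedness gives `L₊ z_k = b_k`, hence `xᵀ L₊ z_k = b_kᵀ
x` and `z_kᵀ L₊ z_k = R_k > 0`.

Current flows only along edges of simple paths between the endpoints
(`exists_isPath_of_edgeDiff_ne_zero`): from an edge carrying current, the potential can be followed
upwards to the source and downwards to the sink. Disjoint path sets thus make the `z_k` orthogonal
for `L₊` (`edgePotential_orthogonal`). Bessel's inequality, `∑ (b_kᵀ x)² / R_k ≤ xᵀ L₊ x`, gives
sufficiency; testing the form at `x = z_k` gives necessity. -/

theorem isMoorePenroseInverse_symmPseudoInverse {n : Type*} [Fintype n]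
    (A : Matrix n n ℝ) (hA : A.IsSymm) : IsMoorePenroseInverse A (symmPseudoInverse A hA) :=
  (exists_isMoorePenroseInverse A hA).choose_spec

theorem IsMoorePenroseInverse.mul_self_mul_of_isSymm {n : Type*} [Fintype n]
    {A X : Matrix n n ℝ} (hX : IsMoorePenroseInverse A X) (hA : A.IsSymm) :
    A * (A * X) = A := by
  rw [← hX.left_symm, transpose_mul, ← Matrix.mul_assoc]
  have h := congrArg transpose hX.mul_mul_self
  simpa [transpose_mul, hA.eq, Matrix.mul_assoc] using h

theorem Matrix.IsSymm.dotProduct_mulVec_comm {n : Type*} [Fintype n]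
    {A : Matrix n n ℝ} (hA : A.IsSymm) (x y : n → ℝ) : x ⬝ᵥ A *ᵥ y = y ⬝ᵥ A *ᵥ x := by
  rw [dotProduct_mulVec, ← mulVec_transpose, hA.eq, dotProduct_comm]

/-- Bessel's inequality for a positive semidefinite form. -/
theorem Matrix.bessel_inequality {n ι : Type*} [Fintype n] [Fintype ι]
    {A : Matrix n n ℝ} (hA : A.IsSymm) (hpos : ∀ x, 0 ≤ x ⬝ᵥ A *ᵥ x)
    (z : ι → n → ℝ) (hz : ∀ i j, i ≠ j → z i ⬝ᵥ A *ᵥ z j = 0)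
    (hz0 : ∀ i, 0 < z i ⬝ᵥ A *ᵥ z i) (x : n → ℝ) :
    ∑ i, (x ⬝ᵥ A *ᵥ z i) ^ 2 / (z i ⬝ᵥ A *ᵥ z i) ≤ x ⬝ᵥ A *ᵥ x := by
  classical
  -- The vector `y` is the projection of `x` onto the span of the `z i`; positivity at `x - y` is
  -- the claim.
  set c : ι → ℝ := fun i => (x ⬝ᵥ A *ᵥ z i) / (z i ⬝ᵥ A *ᵥ z i) with hc
  set y : n → ℝ := ∑ i, c i • z i with hy
  have hw : ∀ w, w ⬝ᵥ A *ᵥ y = ∑ i, c i * (w ⬝ᵥ A *ᵥ z i) := by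
    intro w
    simp [hy, mulVec_sum, dotProduct_sum, mulVec_smul]
  have hyz : ∀ i, y ⬝ᵥ A *ᵥ z i = c i * (z i ⬝ᵥ A *ᵥ z i) := by
    intro i
    rw [hA.dotProduct_mulVec_comm, hw, Finset.sum_eq_single i]
    · intro j _ hj
      rw [hz i j hj.symm, mul_zero]
    · simp
  have hxy : x ⬝ᵥ A *ᵥ y = ∑ i, (x ⬝ᵥ A *ᵥ z i) ^ 2 / (z i ⬝ᵥ A *ᵥ z i) := by
    rw [hw]
    exact Finset.sum_congr rfl fun i _ => by simp only [hc]; ring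
  have hyy : y ⬝ᵥ A *ᵥ y = x ⬝ᵥ A *ᵥ y := by
    rw [hw, hw]
    refine Finset.sum_congr rfl fun i _ => ?_
    rw [hyz, hc]
    dsimp only
    rw [div_mul_cancel₀ _ (hz0 i).ne']
  have h := hpos (x - y)
  rw [mulVec_sub, sub_dotProduct, dotProduct_sub, dotProduct_sub,
    hA.dotProduct_mulVec_comm y x, hyy, hxy] at h
  linarith

/-! ### Edge differences and the Laplacian form -/

namespace WeightedGraph

variable {V : Type*}

/-- The difference of `x` across the pair `e`, oriented as in the incidence matrix. -/
noncomputable def edgeDiff (x : V → ℝ) (e : Sym2 V) : ℝ :=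
  x (Quot.out e).1 - x (Quot.out e).2

theorem edgeDiff_mk (a b : V) :
    (∀ x : V → ℝ, edgeDiff x s(a, b) = x a - x b) ∨
      (∀ x : V → ℝ, edgeDiff x s(a, b) = x b - x a) := by
  have h : s((Quot.out s(a, b)).1, (Quot.out s(a, b)).2) = s(a, b) := Quot.out_eq s(a, b)
  rcases Sym2.eq_iff.1 h with ⟨h₁, h₂⟩ | ⟨h₁, h₂⟩
  · left; intro x; simp only [edgeDiff, h₁, h₂]
  · right; intro x; simp only [edgeDiff, h₁, h₂]

theorem edgeDiff_mk_eq_zero {x : V → ℝ} {a b : V} : edgeDiff x s(a, b) = 0 ↔ x a = x b := by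
  rcases edgeDiff_mk a b with h | h <;> rw [h, sub_eq_zero]
  exact eq_comm

theorem edgeDiff_mk_mul_edgeDiff_mk (x y : V → ℝ) (a b : V) :
    edgeDiff x s(a, b) * edgeDiff y s(a, b) = (x a - x b) * (y a - y b) := by
  rcases edgeDiff_mk a b with h | h <;> rw [h, h]
  ring

theorem dotProduct_laplacian_mulVec [Fintype V] (G : WeightedGraph V) (x y : V → ℝ) :
    x ⬝ᵥ G.laplacian *ᵥ y = ∑ e : G.Edge, G.weight e * (edgeDiff x e.1 * edgeDiff y e.1) := by
  classical
  have h : ∀ z : V → ℝ, z ᵥ* G.incidenceMatrix = fun e => edgeDiff z e.1 := by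
    intro z
    ext e
    simp [vecMul, dotProduct, incidenceMatrix, mul_sub, edgeDiff]
  rw [laplacian, ← mulVec_mulVec, ← mulVec_mulVec, dotProduct_mulVec, h, mulVec_transpose, h]
  simp only [dotProduct, mulVec_diagonal]
  exact Finset.sum_congr rfl fun e _ => by ring

theorem laplacian_mulVec_apply [Fintype V] [DecidableEq V] (G : WeightedGraph V) (x : V → ℝ)
    (a : V) : (G.laplacian *ᵥ x) a =
      ∑ e : G.Edge, G.weight e * (edgeDiff (Pi.single a 1) e.1 * edgeDiff x e.1) := by
  rw [← dotProduct_laplacian_mulVec, single_dotProduct, one_mul]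

/-! ### Support of a flow and simple paths -/

/-- In a graph with positive weights, a node which is not a source of the flow induced by `x` and
has a strictly lower neighbour has a strictly higher one. -/
theorem exists_adj_lt [Fintype V] {H : WeightedGraph V} (hH : ∀ e, 0 < H.weight e)
    {x : V → ℝ} {a b : V} (hx : (H.laplacian *ᵥ x) a ≤ 0) (hab : H.graph.Adj a b)
    (hlt : x b < x a) : ∃ c, H.graph.Adj a c ∧ x a < x c := by
  classical
  -- Without a higher neighbour every term of the net outflow at `a` is nonnegative, and the one
  -- towards `b` is positive.
  by_contra! hcon
  rw [laplacian_mulVec_apply] at hx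
  refine absurd hx (not_le.2 (Finset.sum_pos' ?_ ⟨⟨s(a, b), hab⟩, Finset.mem_univ _, ?_⟩))
  · rintro ⟨e, he⟩ -
    refine mul_nonneg (hH _).le ?_
    induction e with
    | _ p q =>
      have he' : H.graph.Adj p q := he
      rw [edgeDiff_mk_mul_edgeDiff_mk]
      by_cases hp : a = p
      · subst hp
        have := hcon q he'
        simp [he'.ne, this]
      · by_cases hq : a = q
        · subst hq
          have := hcon p he'.symm
          simp [he'.ne, this]
        · simp [Ne.symm hp, Ne.symm hq]
  · refine mul_pos (hH _) ?_
    rw [edgeDiff_mk_mul_edgeDiff_mk]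
    simp [hab.ne, hlt]

/-- A node with a strictly lower neighbour is reached from the only source `u` by a path along
which `x` stays above its final value. -/
theorem exists_isPath_forall_le [Fintype V] {H : WeightedGraph V} (hH : ∀ e, 0 < H.weight e)
    {x : V → ℝ} {u : V} (hx : ∀ a, a ≠ u → (H.laplacian *ᵥ x) a ≤ 0) (a b : V)
    (hab : H.graph.Adj a b) (hlt : x b < x a) :
    ∃ p : H.graph.Walk u a, p.IsPath ∧ ∀ c ∈ p.support, x a ≤ x c := by
  -- Induction runs from higher values of `x` to lower ones.
  have hwf : WellFounded (fun c d : V => x d < x c) :=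
    haveI : IsTrans V (fun c d : V => x d < x c) := ⟨fun _ _ _ h₁ h₂ => h₂.trans h₁⟩
    haveI : Std.Irrefl (fun c d : V => x d < x c) := ⟨fun _ => lt_irrefl _⟩
    Finite.wellFounded_of_trans_of_irrefl _
  induction a using hwf.induction generalizing b with
  | _ a ih =>
    by_cases hau : a = u
    · subst hau
      exact ⟨.nil, by simp, by simp⟩
    · obtain ⟨c, hac, hc⟩ := exists_adj_lt hH (hx a hau) hab hlt
      obtain ⟨p, hp, hle⟩ := ih c hc a hac.symm hc
      -- The node `a` is new: all of `p` lies at or above `x c`, which exceeds `x a`.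
      refine ⟨p.concat hac.symm, hp.concat (fun ha => (hle a ha).not_gt hc) _, ?_⟩
      intro d hd
      rw [SimpleGraph.Walk.support_concat] at hd
      simp only [List.mem_append, List.mem_singleton] at hd
      rcases hd with hd | rfl
      · exact hc.le.trans (hle d hd)
      · exact le_rfl

/-- Every edge carrying a nonzero part of the flow from `u` to `v` lies on a simple path from `u`
to `v`. -/
theorem exists_isPath_of_lt [Fintype V] {H : WeightedGraph V} (hH : ∀ e, 0 < H.weight e)
    {x : V → ℝ} {u v : V} (hu : ∀ a, a ≠ u → (H.laplacian *ᵥ x) a ≤ 0)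
    (hv : ∀ a, a ≠ v → 0 ≤ (H.laplacian *ᵥ x) a) {a b : V}
    (hab : H.graph.Adj a b) (hlt : x b < x a) :
    ∃ p : H.graph.Walk u v, p.IsPath ∧ s(a, b) ∈ p.edges := by
  obtain ⟨p, hp, hple⟩ := exists_isPath_forall_le hH hu a b hab hlt
  obtain ⟨q, hq, hqle⟩ := exists_isPath_forall_le (x := -x) (u := v) hH
    (fun c hc => by rw [mulVec_neg, Pi.neg_apply, neg_nonpos]; exact hv c hc) b a hab.symm
    (by simpa using hlt)
  refine ⟨p.append (.cons hab q.reverse), .mk' ?_, by simp⟩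
  rw [SimpleGraph.Walk.support_append, SimpleGraph.Walk.support_cons, List.tail_cons,
    List.nodup_append']
  -- The two halves cannot meet: one stays at or above `x a`, the other at or below `x b`.
  refine ⟨hp.support_nodup, hq.reverse.support_nodup, fun c hc hc' => ?_⟩
  rw [SimpleGraph.Walk.support_reverse, List.mem_reverse] at hc'
  have h₁ := hple c hc
  have h₂ := hqle c hc'
  simp only [Pi.neg_apply, neg_le_neg_iff] at h₂
  linarith

theorem exists_isPath_of_edgeDiff_ne_zero [Fintype V] [DecidableEq V] {H : WeightedGraph V}
    (hH : ∀ e, 0 < H.weight e) {x : V → ℝ} {u v : V}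
    (hx : H.laplacian *ᵥ x = Pi.single u 1 - Pi.single v 1) {e : Sym2 V}
    (he : e ∈ H.graph.edgeSet) (hne : edgeDiff x e ≠ 0) :
    ∃ p : H.graph.Walk u v, p.IsPath ∧ e ∈ p.edges := by
  have hu : ∀ a, a ≠ u → (H.laplacian *ᵥ x) a ≤ 0 := fun a ha => by
    rw [hx]; simp only [Pi.sub_apply, Pi.single_apply, if_neg ha]; split_ifs <;> norm_num
  have hv : ∀ a, a ≠ v → 0 ≤ (H.laplacian *ᵥ x) a := fun a ha => by
    rw [hx]; simp only [Pi.sub_apply, Pi.single_apply, if_neg ha]; split_ifs <;> norm_num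
  induction e with
  | _ a b =>
    have hab : H.graph.Adj a b := he
    rw [Ne, edgeDiff_mk_eq_zero] at hne
    rcases lt_or_gt_of_ne hne with h | h
    · rw [Sym2.eq_swap]
      exact exists_isPath_of_lt hH hu hv hab.symm h
    · exact exists_isPath_of_lt hH hu hv hab h

/-! ### Kernel of the Laplacian and the Poisson equation -/

theorem dotProduct_laplacian_mulVec_self_nonneg [Fintype V] {H : WeightedGraph V}
    (hH : ∀ e, 0 < H.weight e) (x : V → ℝ) : 0 ≤ x ⬝ᵥ H.laplacian *ᵥ x := by
  rw [dotProduct_laplacian_mulVec]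
  exact Finset.sum_nonneg fun e _ => mul_nonneg (hH e).le (mul_self_nonneg _)

/-- The Laplacian form of a connected graph with positive weights vanishes only at constants. -/
theorem eq_of_dotProduct_laplacian_mulVec_eq_zero [Fintype V] {H : WeightedGraph V}
    (hH : ∀ e, 0 < H.weight e) (hconn : H.graph.Connected) {x : V → ℝ}
    (hx : x ⬝ᵥ H.laplacian *ᵥ x = 0) (a b : V) : x a = x b := by
  rw [dotProduct_laplacian_mulVec, Finset.sum_eq_zero_iff_of_nonneg
    (fun e _ => mul_nonneg (hH e).le (mul_self_nonneg _))] at hx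
  obtain ⟨p⟩ := hconn.preconnected a b
  induction p with
  | nil => rfl
  | @cons c d _ h _ ih =>
    have h0 := hx ⟨s(c, d), h⟩ (Finset.mem_univ _)
    rw [mul_eq_zero, or_iff_right (hH _).ne', mul_self_eq_zero, edgeDiff_mk_eq_zero] at h0
    exact h0.trans ih

/-- In a connected graph with positive weights, the pseudo-inverse of the Laplacian solves the
Poisson equation for every source of total mass zero. -/
theorem laplacian_mulVec_symmPseudoInverse_mulVec [Fintype V] {H : WeightedGraph V}
    (hH : ∀ e, 0 < H.weight e) (hconn : H.graph.Connected) {b : V → ℝ} (hb : ∑ a, b a = 0) :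
    H.laplacian *ᵥ (symmPseudoInverse H.laplacian H.laplacian_isSymm *ᵥ b) = b := by
  set L := H.laplacian with hL
  set X := symmPseudoInverse L H.laplacian_isSymm
  have hX : IsMoorePenroseInverse L X := isMoorePenroseInverse_symmPseudoInverse _ _
  -- The residual `y` lies in the kernel, so it is constant; its entries sum to zero, so it
  -- vanishes.
  set y := b - L *ᵥ (X *ᵥ b) with hy
  have hLy : L *ᵥ y = 0 := by
    rw [hy, mulVec_sub, mulVec_mulVec, mulVec_mulVec, Matrix.mul_assoc,
      hX.mul_self_mul_of_isSymm H.laplacian_isSymm, sub_self]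
  have hconst := eq_of_dotProduct_laplacian_mulVec_eq_zero hH hconn (x := y)
    (by rw [← hL, hLy, dotProduct_zero])
  have hone : ∀ z, ∑ a, (L *ᵥ z) a = 0 := by
    intro z
    have h : (1 : V → ℝ) ⬝ᵥ L *ᵥ z = 0 := by
      rw [hL, dotProduct_laplacian_mulVec]
      simp [edgeDiff]
    rwa [one_dotProduct] at h
  have hsum : ∑ a, y a = 0 := by
    simp only [hy, Pi.sub_apply, Finset.sum_sub_distrib, hb, hone, sub_zero]
  have hy0 : y = 0 := by
    ext a
    rw [Finset.sum_congr rfl fun c _ => hconst c a, Finset.sum_const, nsmul_eq_mul] at hsum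
    have : Nonempty V := ⟨a⟩
    exact (mul_eq_zero.1 hsum).resolve_left (by simp)
  exact (sub_eq_zero.1 hy0).symm

/-! ### Potentials of unit flows -/

open Classical in
/-- The unit source at the endpoints of `e`, oriented as in the incidence matrix. -/
noncomputable def edgeSource (e : Sym2 V) : V → ℝ :=
  Pi.single (Quot.out e).1 1 - Pi.single (Quot.out e).2 1

theorem dotProduct_edgeSource [Fintype V] (x : V → ℝ) (e : Sym2 V) :
    x ⬝ᵥ edgeSource e = edgeDiff x e := by
  simp [edgeSource, edgeDiff, dotProduct_sub]

theorem sum_edgeSource [Fintype V] (e : Sym2 V) : ∑ a, edgeSource e a = 0 := by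
  simp [edgeSource]

/-- The potential induced by a unit flow between the endpoints of `e`. -/
noncomputable def edgePotential [Fintype V] (H : WeightedGraph V) (e : Sym2 V) : V → ℝ :=
  symmPseudoInverse H.laplacian H.laplacian_isSymm *ᵥ edgeSource e

theorem edgeDiff_edgePotential [Fintype V] (H : WeightedGraph V) (e : Sym2 V) :
    edgeDiff (H.edgePotential e) e = H.pairResistance e := by
  have h : H.pairResistance e = H.effectiveResistance (Quot.out e).1 (Quot.out e).2 := by
    conv_lhs => rw [← Quot.out_eq e]
    rfl
  rw [h, ← dotProduct_edgeSource, dotProduct_comm]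
  rfl

theorem dotProduct_laplacian_mulVec_edgePotential [Fintype V] {H : WeightedGraph V}
    (hH : ∀ e, 0 < H.weight e) (hconn : H.graph.Connected) (x : V → ℝ) (e : Sym2 V) :
    x ⬝ᵥ H.laplacian *ᵥ H.edgePotential e = edgeDiff x e := by
  rw [edgePotential, laplacian_mulVec_symmPseudoInverse_mulVec hH hconn (sum_edgeSource e),
    dotProduct_edgeSource]

theorem pairResistance_pos [Fintype V] {H : WeightedGraph V}
    (hH : ∀ e, 0 < H.weight e) (hconn : H.graph.Connected) {e : Sym2 V}
    (he : ¬ e.IsDiag) : 0 < H.pairResistance e := by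
  rw [← edgeDiff_edgePotential, ← dotProduct_laplacian_mulVec_edgePotential hH hconn]
  refine lt_of_le_of_ne (dotProduct_laplacian_mulVec_self_nonneg hH _) fun h => ?_
  have hc := eq_of_dotProduct_laplacian_mulVec_eq_zero hH hconn h.symm
  -- A constant potential pairs to zero with everything, but its pairing with `edgeSource e` is `1 -
  -- (-1) = 2`.
  have h1 := dotProduct_laplacian_mulVec_edgePotential hH hconn (edgeSource e) e
  rw [H.laplacian_isSymm.dotProduct_mulVec_comm, dotProduct_laplacian_mulVec] at h1
  have hne : (Quot.out e).1 ≠ (Quot.out e).2 := by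
    intro h2
    apply he
    rw [← Quot.out_eq e]
    exact h2
  have h3 : edgeDiff (edgeSource e) e = 2 := by
    simp only [edgeDiff, edgeSource, Pi.sub_apply, Pi.single_apply, if_neg hne, if_neg hne.symm,
      if_true]
    norm_num
  have h4 : ∀ f : Sym2 V, edgeDiff (H.edgePotential e) f = 0 := fun f => sub_eq_zero.2 (hc _ _)
  simp only [h3, h4, zero_mul, mul_zero, Finset.sum_const_zero] at h1
  norm_num at h1

/-! ### Negative edges and the criterion -/

theorem posPart_weight_pos (G : WeightedGraph V) (e : G.posPart.Edge) :
    0 < G.posPart.weight e := by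
  obtain ⟨e, he⟩ := e
  induction e with
  | _ u v => exact he.2

/-- The Laplacian form splits into the form of the positive part and the negative edges. -/
theorem dotProduct_laplacian_mulVec_self_eq_sub [Fintype V] (G : WeightedGraph V) (x : V → ℝ) :
    x ⬝ᵥ G.laplacian *ᵥ x = x ⬝ᵥ G.posPart.laplacian *ᵥ x -
      ∑ k : G.NegEdge, |G.weight k.1| * edgeDiff x k.1.1 ^ 2 := by
  classical
  rw [dotProduct_laplacian_mulVec, dotProduct_laplacian_mulVec,
    ← Fintype.sum_subtype_add_sum_subtype (fun e : G.Edge => G.weight e < 0), add_comm,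
    sub_eq_add_neg, ← Finset.sum_neg_distrib]
  congr 1
  · have hmem : ∀ e : G.posPart.Edge, e.1 ∈ G.graph.edgeSet := by
      rintro ⟨e, he⟩
      induction e with
      | _ u v => exact he.1
    refine (Fintype.sum_bijective
      (fun e : G.posPart.Edge => (⟨⟨e.1, hmem e⟩, (G.posPart_weight_pos e).not_gt⟩ :
        {e : G.Edge // ¬ G.weight e < 0})) ⟨?_, ?_⟩ _ _ fun e => rfl).symm
    · intro e f hef
      exact Subtype.ext (congrArg (fun g => g.1.1) hef)
    · rintro ⟨⟨e, he⟩, hw⟩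
      have hpos := lt_of_le_of_ne (not_lt.1 hw) (G.weight_ne_zero ⟨e, he⟩).symm
      refine ⟨⟨e, ?_⟩, rfl⟩
      induction e with
      | _ u v => exact ⟨he, hpos⟩
  · refine Finset.sum_congr (by congr!) fun k _ => ?_
    rw [abs_of_neg k.2]
    ring

/-- The potentials of negative edges joined by disjoint sets of paths are orthogonal. -/
theorem edgePotential_orthogonal [Fintype V] (G : WeightedGraph V)
    (hconn : G.posPart.graph.Connected) {i j : G.NegEdge}
    (hdisj : Disjoint (G.pathEdges i) (G.pathEdges j)) :
    G.posPart.edgePotential i.1.1 ⬝ᵥ G.posPart.laplacian *ᵥ G.posPart.edgePotential j.1.1 = 0 := by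
  classical
  have hmem : ∀ (k : G.NegEdge) (e : G.posPart.Edge),
      edgeDiff (G.posPart.edgePotential k.1.1) e.1 ≠ 0 → e.1 ∈ G.pathEdges k := by
    intro k e hne
    refine ⟨_, _, (Quot.out_eq k.1.1).symm,
      exists_isPath_of_edgeDiff_ne_zero G.posPart_weight_pos ?_ e.2 hne⟩
    rw [edgePotential, laplacian_mulVec_symmPseudoInverse_mulVec G.posPart_weight_pos hconn
      (sum_edgeSource _), edgeSource]
    congr!
  rw [dotProduct_laplacian_mulVec]
  refine Finset.sum_eq_zero fun e _ => ?_
  by_contra hne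
  rw [mul_eq_zero, mul_eq_zero, not_or, not_or] at hne
  exact Set.disjoint_left.1 hdisj (hmem i e hne.2.1) (hmem j e hne.2.2)

theorem posSemidef_laplacian_iff [Fintype V] (G : WeightedGraph V) :
    G.laplacian.PosSemidef ↔ ∀ x : V → ℝ, 0 ≤ x ⬝ᵥ G.laplacian *ᵥ x := by
  rw [posSemidef_iff_dotProduct_mulVec, IsHermitian, conjTranspose_eq_transpose_of_trivial]
  simp only [star_trivial, and_iff_right_iff_imp]
  exact fun _ => G.laplacian_isSymm

theorem pairResistance_posPart_pos [Fintype V] (G : WeightedGraph V)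
    (hconn : G.posPart.graph.Connected) (k : G.NegEdge) :
    0 < G.posPart.pairResistance k.1.1 :=
  pairResistance_pos G.posPart_weight_pos hconn (G.graph.not_isDiag_of_mem_edgeSet k.1.2)

/-- The Laplacian is positive semidefinite exactly if no negative weight exceeds in absolute value
the effective conductance between its endpoints. -/
theorem posSemidef_laplacian_iff_forall_abs_weight_le [Fintype V] (G : WeightedGraph V)
    (hconn : G.posPart.graph.Connected)
    (hdisj : ∀ i j : G.NegEdge, i ≠ j → Disjoint (G.pathEdges i) (G.pathEdges j)) :
    G.laplacian.PosSemidef ↔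
      ∀ k : G.NegEdge, |G.weight k.1| ≤ (G.posPart.pairResistance k.1.1)⁻¹ := by
  have hpos := G.posPart_weight_pos
  have hR := G.pairResistance_posPart_pos hconn
  have hself : ∀ k : G.NegEdge, G.posPart.edgePotential k.1.1 ⬝ᵥ
      G.posPart.laplacian *ᵥ G.posPart.edgePotential k.1.1 = G.posPart.pairResistance k.1.1 := by
    intro k
    rw [dotProduct_laplacian_mulVec_edgePotential hpos hconn, edgeDiff_edgePotential]
  rw [posSemidef_laplacian_iff]
  constructor
  · intro h k
    have hk := h (G.posPart.edgePotential k.1.1)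
    -- The other negative edges only lower the form, so keeping the term of `k` gives `|w_k| R_k² ≤
    -- R_k`.
    have hle := Finset.single_le_sum (s := Finset.univ) (f := fun i : G.NegEdge =>
      |G.weight i.1| * edgeDiff (G.posPart.edgePotential k.1.1) i.1.1 ^ 2)
      (fun i _ => by positivity) (Finset.mem_univ k)
    rw [dotProduct_laplacian_mulVec_self_eq_sub, hself] at hk
    simp only [edgeDiff_edgePotential] at hle
    rw [le_inv_comm₀ (abs_pos.2 (G.weight_ne_zero _)) (hR k), ← one_div,
      le_div_iff₀ (abs_pos.2 (G.weight_ne_zero _))]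
    refine le_of_mul_le_mul_right ?_ (hR k)
    linarith
  · intro h x
    rw [dotProduct_laplacian_mulVec_self_eq_sub, sub_nonneg]
    refine le_trans (Finset.sum_le_sum fun k _ => ?_)
      (bessel_inequality G.posPart.laplacian_isSymm
        (dotProduct_laplacian_mulVec_self_nonneg hpos)
        (fun k : G.NegEdge => G.posPart.edgePotential k.1.1)
        (fun i j hij => G.edgePotential_orthogonal hconn (hdisj i j hij))
        (fun k => by rw [hself]; exact hR k) x)
    rw [hself, dotProduct_laplacian_mulVec_edgePotential hpos hconn, div_eq_inv_mul]
    exact mul_le_mul_of_nonneg_right (h k) (sq_nonneg _)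

end WeightedGraph

theorem mainTheorem2 {V : Type*} [Fintype V] (G : WeightedGraph V)
    (hconn : G.posPart.graph.Connected)
    (hneg : 1 < Fintype.card G.NegEdge)
    (hdisj : ∀ i j : G.NegEdge, i ≠ j → Disjoint (G.pathEdges i) (G.pathEdges j)) :
    IsUnit G.resistanceMatrix ∧
      (G.laplacian.PosSemidef ↔
        (G.resistanceMatrix⁻¹ - G.absNegWeightMatrix).PosSemidef) := by

  have hR := G.pairResistance_posPart_pos hconn
  have hmul : G.resistanceMatrix *
      diagonal (fun k => (G.posPart.pairResistance k.1.1)⁻¹) = 1 := by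
    rw [WeightedGraph.resistanceMatrix, diagonal_mul_diagonal, ← diagonal_one]
    exact congrArg diagonal (funext fun k => mul_inv_cancel₀ (hR k).ne')
  refine ⟨IsUnit.of_mul_eq_one _ hmul, ?_⟩
  rw [G.posSemidef_laplacian_iff_forall_abs_weight_le hconn hdisj, inv_eq_right_inv hmul,
    WeightedGraph.absNegWeightMatrix, diagonal_sub, posSemidef_diagonal_iff]
  exact forall_congr' fun k => sub_nonneg.symm
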